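/- Let $\mathcal T$ be a $\mathbb C$-linear triangulated category with finite-dimensional Hom-spaces which has a Serre functor $\mathcal S$ (a triangulated autoequivalence with natural isomorphisms $\mathrm{Hom}(X,Y)\cong\mathrm{Hom}(Y,\mathcal S X)^*$) and a split-generator $G$ (for instance $\mathcal T\simeq\mathrm{perf}(A)$ for a smooth proper differential graded $\mathbb C$-algebra $A$). For $t\in\mathbb R$ and $E\in\mathcal T$ let $\delta_t(G,E)$ be the infimum of $\sum_{i=1}^p e^{n_it}$ over all chains $0=M_0\to M_1\to\cdots\to M_p=E\oplus M$ (with $M\in\mathcal T$ arbitrary) in which each step fits into an exact triangle $M_{i-1}\to M_i\to G[n_i]\to M_{i-1}[1]$. The upper Serre dimension of $\mathcal T$ is $$\overline{\mathrm{Sdim}}\,\mathcal T:=\lim_{t\to+\infty}\frac{h_t(\mathcal S)}{t}\in[-\infty,+\infty],\qquad h_t(\mathcal S):=\lim_{n\to+\infty}\frac1n\log\delta_t(G,\mathcal S^nG).$$ We say that $\overline{\mathrm{Sdim}}\,\mathcal T$ is defined if such $\mathcal S$ and $G$ exist and these limits exist. Let $\Lambda$ be a finitely generated free abelian group, $v:K(\mathcal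 T)\to\Lambda$ a surjective homomorphism, and $\|\cdot\|$ a norm on $\Lambda\otimes_{\mathbb Z}\mathbb R$. Let $\sigma=(Z,\{\mathcal P(\phi)\}_{\phi\in\mathbb R})$ be a Bridgeland stability condition on $\mathcal T$ with respect to $(\Lambda,v)$, with the support property $\|v(E)\|<C|Z(v(E))|$ for all nonzero $E\in\mathcal P(\phi)$, $\phi\in\mathbb R$, for some constant $C>0$, and let $$\mathrm{gldim}\,\sigma:=\sup\{\phi_2-\phi_1\mid \mathrm{Hom}_{\mathcal T}(E_1,E_2)\ne0\text{ for some }E_i\in\mathcal P(\phi_i)\}.$$ Suppose that $\overline{\mathrm{Sdim}}\,\mathcal T$ is defined and $\overline{\mathrm{Sdim}}\,\mathcal T=\mathrm{gldim}\,\sigma\le1$. Let $\mathcal T'\subset\mathcal T$ be a nonzero admissible triangulated subcategory, that is, a full triangulated subcategory whose inclusion functor has a left and a right adjoint. Then $\overline{\mathrm{Sdim}}\,\mathcal T'$ is defined (in particular $\mathcal T'$ has a Serre functor and a split-generator), and $$\overline{\mathrm{Sdim}}\,\mathcal T'\le\overline{\mathrm{Sdim}}\,\mathcal T$$ for every choice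 of Serre functor and split-generator of $\mathcal T'$ used to compute the left-hand side. -/

import Mathlib

open CategoryTheory CategoryTheory.Limits CategoryTheory.Pretriangulated Filter Topology
open scoped ENNReal TensorProduct

universe v u w

noncomputable section

namespace SerreDim

section Basic

variable (T : Type u) [Category.{v} T] [HasZeroObject T] [HasShift T ℤ] [Preadditive T]
  [∀ n : ℤ, (shiftFunctor T n).Additive] [Pretriangulated T]

/-- The Grothendieck group `K(T)`: the free abelian group on the objects of `T` modulo
`[Y] = [X] + [Z]` for every distinguished triangle `X ⟶ Y ⟶ Z ⟶ X[1]`. -/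
abbrev K0 : Type u :=
  FreeAbelianGroup T ⧸ AddSubgroup.closure
    {x : FreeAbelianGroup T | ∃ Δ ∈ distTriang T,
      x = FreeAbelianGroup.of Δ.obj₂ - FreeAbelianGroup.of Δ.obj₁ - FreeAbelianGroup.of Δ.obj₃}

variable {T}

/-- The class `[E]` of an object in the Grothendieck group. -/
def K0.cls (E : T) : K0 T := QuotientAddGroup.mk (FreeAbelianGroup.of E)

/-- `HasTower A E`: there is a chain `0 = M 0 ⟶ M 1 ⟶ ⋯ ⟶ M p ≅ E` and, for each `i`, a
distinguished triangle `M i ⟶ M (i + 1) ⟶ A i ⟶ (M i)[1]`. -/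
def HasTower {p : ℕ} (A : Fin p → T) (E : T) : Prop :=
  ∃ M : Fin (p + 1) → T, IsZero (M 0) ∧ Nonempty (M (Fin.last p) ≅ E) ∧
    ∀ i : Fin p, ∃ (f : M i.castSucc ⟶ M i.succ) (g : M i.succ ⟶ A i)
      (h : A i ⟶ (M i.castSucc)⟦(1 : ℤ)⟧), Triangle.mk f g h ∈ distTriang T

/-- `G` is a split-generator: the smallest triangulated subcategory of `T` that contains `G` and
is closed under direct summands is `T` itself. -/
def IsSplitGenerator (G : T) : Prop :=
  (ObjectProperty.singleton G).IsClassicalTriangulatedGenerator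

/-- The complexity `δ_t(G, E)`: the infimum of `∑ exp (n i * t)` over all towers with graded pieces
`G[n 0], …, G[n (p-1)]` whose top is `E ⊕ M` for some object `M`. -/
def complexity (t : ℝ) (G E : T) : ℝ≥0∞ :=
  sInf {x : ℝ≥0∞ | ∃ (p : ℕ) (n : Fin p → ℤ) (M : T),
    HasTower (fun i => G⟦n i⟧) (E ⊞ M) ∧
      x = ∑ i, ENNReal.ofReal (Real.exp ((n i : ℝ) * t))}

/-- `h` is the value `h_t(F) = lim (1/n) log δ_t(G, Fⁿ G)` of the entropy of `F` at `t`, computed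
with `G`; the limit is taken in `[-∞, ∞]`. -/
def IsEntropyAt (F : T ⥤ T) (G : T) (t : ℝ) (h : EReal) : Prop :=
  Tendsto (fun n : ℕ => ENNReal.log (complexity t G (F.obj^[n] G)) / ((n : ℝ) : EReal))
    atTop (𝓝 h)

end Basic

section Serre

variable (T : Type u) [Category.{v} T] [HasZeroObject T] [HasShift T ℤ] [Preadditive T]
  [∀ n : ℤ, (shiftFunctor T n).Additive] [Pretriangulated T] [Linear ℂ T]

/-- A Serre functor: a triangulated autoequivalence `S` with `ℂ`-linear isomorphisms
`Hom(X, Y) ≅ Hom(Y, S X)^*` that are natural in `X` and `Y`. -/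
structure SerreFunctor where
  functor : T ⥤ T
  commShift : functor.CommShift ℤ
  isTriangulated : functor.IsTriangulated
  isEquivalence : functor.IsEquivalence
  duality (X Y : T) : (X ⟶ Y) ≃ₗ[ℂ] Module.Dual ℂ (Y ⟶ functor.obj X)
  duality_natural {X X' Y Y' : T} (f : X' ⟶ X) (a : X ⟶ Y) (g : Y ⟶ Y')
    (b : Y' ⟶ functor.obj X') :
    duality X' Y' (f ≫ a ≫ g) b = duality X Y a (g ≫ b ≫ functor.map f)

/-- `d ∈ [-∞, ∞]` is the upper Serre dimension of `T`: for a Serre functor `S` and a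
split-generator `G` of `T`, the entropy `h_t(S)` exists for all real `t`, and
`h_t(S) / t` tends to `d` as `t → +∞`. -/
def IsUpperSerreDim (d : EReal) : Prop :=
  ∃ (S : SerreFunctor T) (G : T) (h : ℝ → EReal), IsSplitGenerator G ∧
    (∀ t : ℝ, IsEntropyAt S.functor G t (h t)) ∧
    Tendsto (fun t : ℝ => h t / (t : EReal)) atTop (𝓝 d)

end Serre

section Stability

variable (T : Type u) [Category.{v} T] [HasZeroObject T] [HasShift T ℤ] [Preadditive T]
  [∀ n : ℤ, (shiftFunctor T n).Additive] [Pretriangulated T]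

/-- A Bridgeland stability condition `(Z, P)` on `T` with respect to `v : K(T) → Λ`. The support
property is formulated with the norm `N` on `ℝ ⊗ Λ`. -/
structure StabilityCondition {Λ : Type w} [AddCommGroup Λ] (v : K0 T →+ Λ)
    (N : Seminorm ℝ (ℝ ⊗[ℤ] Λ)) where
  /-- the central charge -/
  Z : Λ →+ ℂ
  /-- the slicing -/
  P : ℝ → ObjectProperty T
  /-- each `P φ` is a full additive subcategory (closed under isomorphisms) -/
  closedUnderIso (φ : ℝ) {E F : T} : (E ≅ F) → P φ E → P φ F
  zero_mem (φ : ℝ) {E : T} : IsZero E → P φ E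
  biprod_mem (φ : ℝ) {E F : T} : P φ E → P φ F → P φ (E ⊞ F)
  charge (φ : ℝ) (E : T) : P φ E → ¬ IsZero E →
    ∃ m : ℝ, 0 < m ∧ Z (v (K0.cls E)) = m * Complex.exp (Complex.I * Real.pi * φ)
  shift (φ : ℝ) (E : T) : P (φ + 1) (E⟦(1 : ℤ)⟧) ↔ P φ E
  hom_eq_zero {φ₁ φ₂ : ℝ} {E₁ E₂ : T} : φ₂ < φ₁ → P φ₁ E₁ → P φ₂ E₂ → ∀ f : E₁ ⟶ E₂, f = 0
  /-- existence of Harder–Narasimhan filtrations -/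
  harderNarasimhan (E : T) : ¬ IsZero E →
    ∃ (p : ℕ) (φ : Fin p → ℝ) (A : Fin p → T),
      StrictAnti φ ∧ (∀ i, P (φ i) (A i)) ∧ HasTower A E
  /-- the support property -/
  support : ∃ C : ℝ, 0 < C ∧ ∀ (φ : ℝ) (E : T), P φ E → ¬ IsZero E →
    N ((1 : ℝ) ⊗ₜ[ℤ] v (K0.cls E)) < C * ‖Z (v (K0.cls E))‖

variable {T}

/-- The global dimension of a stability condition. -/
def StabilityCondition.gldim {Λ : Type w} [AddCommGroup Λ] {v : K0 T →+ Λ}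
    {N : Seminorm ℝ (ℝ ⊗[ℤ] Λ)} (σ : StabilityCondition T v N) : EReal :=
  sSup {x : EReal | ∃ (φ₁ φ₂ : ℝ) (E₁ E₂ : T), σ.P φ₁ E₁ ∧ σ.P φ₂ E₂ ∧
    (∃ f : E₁ ⟶ E₂, f ≠ 0) ∧ x = ((φ₂ - φ₁ : ℝ) : EReal)}

end Stability

/-- The full subcategory given by `P` is admissible: its inclusion functor has a left and a right
adjoint. -/
def IsAdmissible {T : Type u} [Category.{v} T] (P : ObjectProperty T) : Prop :=
  P.ι.IsLeftAdjoint ∧ P.ι.IsRightAdjoint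

end SerreDim

end

namespace SerreDim

/-! ### Objects built from shifts of a generator. -/

section Filtrations

variable {T : Type u} [Category.{v} T] [HasZeroObject T] [HasShift T ℤ] [Preadditive T]
  [∀ n : ℤ, (shiftFunctor T n).Additive] [Pretriangulated T]

/-! For large `t` the sum of the `exp (n i * t)` is governed by the largest shift. So, after
Fekete's lemma, the upper Serre dimension is the asymptotic slope of the largest shift needed to
build `Sⁿ G` from `G` (`shiftGrowth`, `tendsto_entropy_div`). In particular it exists as soon as a
Serre functor and a split-generator do.

Global dimension at most `g ≤ 1` kills the connecting maps in Harder–Narasimhan filtrations, so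
every object is a direct sum of semistable ones (`sumsOf_of_hasTower`). Such a `SplitSlicing` bounds
the Serre dimension by `g`, for two reasons. Serre duality shows that `S` raises the largest phase
by at most `g` (`sumsOf_serreFunctor_obj`). And an object with phases at most `r` is built from `G`
with shifts at most `r` plus a constant (`exists_built_of_sumsOf`).

An admissible subcategory is closed under retracts up to isomorphism, so it contains the semistable
summands of its objects and inherits the split slicing with the same `g` (`SplitSlicing.comap`). A
general stability condition would not restrict this way. The subcategory has the Serre functor `R S
F`, where `F` is the inclusion and `R` its right adjoint, and the split-generator `R G`. Letting `g`
decrease to the Serre dimension of `T` gives the inequality. -/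

lemma exists_distTriang_iso_zero {X Y Z : T} (e : X ≅ Y) (hZ : IsZero Z) :
    ∃ (f : X ⟶ Y) (g : Y ⟶ Z) (h : Z ⟶ X⟦(1 : ℤ)⟧), Triangle.mk f g h ∈ distTriang T :=
  ⟨e.hom, 0, 0, (Triangle.distinguished_iff_of_isZero₃ _ hZ).2
    (inferInstanceAs (IsIso e.hom))⟩

/-- A retract in a pretriangulated category is a direct summand. -/
lemma exists_iso_biprod_of_retract {X Y : T} (r : Retract X Y) :
    ∃ M : T, Nonempty (Y ≅ X ⊞ M) := by
  obtain ⟨M, g, h, mem⟩ := distinguished_cocone_triangle r.i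
  have : Mono r.i := (SplitMono.mk r.r r.retract).mono
  obtain ⟨e, -⟩ := exists_iso_binaryBiproduct_of_distTriang _ mem
    ((Triangle.mor₃_eq_zero_iff_mono₁ _ mem).2 this)
  exact ⟨M, ⟨e⟩⟩

/-- `filt G l X`: the object `X` has a finite filtration whose successive quotients are the
shifts `G⟦k⟧` for `k` in the list `l`, the head of `l` giving the last quotient. -/
def filt (G : T) : List ℤ → ObjectProperty T
  | [] => IsZero
  | n :: l => (filt G l).extensionProduct fun X => Nonempty (X ≅ G⟦n⟧)

lemma filt_of_iso {G : T} {l : List ℤ} {X Y : T} (e : X ≅ Y) (hX : filt G l X) :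
    filt G l Y := by
  cases l with
  | nil => exact IsZero.of_iso hX e.symm
  | cons n l =>
    exact (ObjectProperty.extensionProduct (filt G l) _).prop_of_iso e hX

lemma filt_singleton (G : T) (n : ℤ) : filt G [n] (G⟦n⟧) := by
  obtain ⟨f, g, h, H⟩ := exists_distTriang_iso_zero (Iso.refl (G⟦n⟧)) (isZero_zero T)
  refine ⟨_, _, _, _, _, inv_rot_of_distTriang _ H, ?_, ⟨Iso.refl _⟩⟩
  exact Functor.map_isZero _ (isZero_zero T)

/-- `built G l X`: the object `X` is a direct summand of an object filtered by the shifts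
`G⟦k⟧`, `k ∈ l`. -/
def built (G : T) (l : List ℤ) : ObjectProperty T := (filt G l).retractClosure

lemma built_of_retract {G : T} {l : List ℤ} {X Y : T} (r : Retract X Y) (h : built G l Y) :
    built G l X :=
  (filt G l).retractClosure.prop_of_retract r h

lemma built_of_iso {G : T} {l : List ℤ} {X Y : T} (e : X ≅ Y) (h : built G l X) :
    built G l Y := built_of_retract (Retract.ofIso e.symm) h

lemma built_of_filt {G : T} {l : List ℤ} {X : T} (h : filt G l X) : built G l X :=
  ObjectProperty.le_retractClosure _ _ h

lemma built_of_isZero {G X : T} (h : IsZero X) : built G [] X := built_of_filt h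

lemma built_singleton (G : T) (n : ℤ) : built G [n] (G⟦n⟧) := built_of_filt (filt_singleton G n)

lemma built_self (G : T) : built G [0] G :=
  built_of_iso ((shiftFunctorZero T ℤ).app G) (built_singleton G 0)

lemma filt_shift {G : T} {l : List ℤ} {X : T} (h : filt G l X) (n : ℤ) :
    filt G (l.map (· + n)) (X⟦n⟧) := by
  induction l generalizing X with
  | nil => exact Functor.map_isZero _ h
  | cons k l ih =>
    obtain ⟨Y, Z, f, g, δ, H, hY, ⟨e⟩⟩ := h
    exact ⟨_, _, _, _, _, Triangle.shift_distinguished _ H n, ih hY,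
      ⟨(shiftFunctor T n).mapIso e ≪≫ ((shiftFunctorAdd T k n).app G).symm⟩⟩

lemma built_shift {G : T} {l : List ℤ} {X : T} (h : built G l X) (n : ℤ) :
    built G (l.map (· + n)) (X⟦n⟧) := by
  obtain ⟨Y, hY, ⟨r⟩⟩ := h
  exact ⟨Y⟦n⟧, filt_shift hY n, ⟨r.map (shiftFunctor T n)⟩⟩

section Functor

variable {T' : Type*} [Category* T'] [HasZeroObject T'] [HasShift T' ℤ] [Preadditive T']
  [∀ n : ℤ, (shiftFunctor T' n).Additive] [Pretriangulated T']
  (F : T ⥤ T') [F.CommShift ℤ] [F.IsTriangulated]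

lemma filt_map {G : T} {l : List ℤ} {X : T} (h : filt G l X) :
    filt (F.obj G) l (F.obj X) := by
  induction l generalizing X with
  | nil => exact Functor.map_isZero F h
  | cons k l ih =>
    obtain ⟨Y, Z, f, g, δ, H, hY, ⟨e⟩⟩ := h
    exact ⟨_, _, _, _, _, F.map_distinguished _ H, ih hY,
      ⟨F.mapIso e ≪≫ (F.commShiftIso k).app G⟩⟩

lemma built_map {G : T} {l : List ℤ} {X : T} (h : built G l X) :
    built (F.obj G) l (F.obj X) := by
  obtain ⟨Y, hY, ⟨r⟩⟩ := h
  exact ⟨F.obj Y, filt_map F hY, ⟨r.map F⟩⟩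

end Functor

section Octahedral

variable [IsTriangulated T]

/-- The octahedral axiom enters here, as associativity of the extension product. -/
lemma filt_append (G : T) (l₁ l₂ : List ℤ) :
    (filt G l₁).extensionProduct (filt G l₂) ≤ filt G (l₂ ++ l₁) := by
  induction l₂ with
  | nil =>
    rintro X ⟨Y, Z, f, g, δ, H, hY, hZ⟩
    have : IsIso f := (Triangle.isZero₃_iff_isIso₁ _ H).1 hZ
    exact filt_of_iso (asIso f) hY
  | cons n l₂ ih =>
    change (filt G l₁).extensionProduct ((filt G l₂).extensionProduct _) ≤ _
    rw [← ObjectProperty.extensionProduct_assoc]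
    exact ObjectProperty.monotone_extensionProduct_left _ ih

lemma built_append {G : T} {l₁ l₂ : List ℤ} {X Y Z : T} {f : X ⟶ Y} {g : Y ⟶ Z}
    {δ : Z ⟶ X⟦(1 : ℤ)⟧} (H : Triangle.mk f g δ ∈ distTriang T) (hX : built G l₁ X)
    (hZ : built G l₂ Z) : built G (l₂ ++ l₁) Y :=
  ObjectProperty.monotone_retractClosure (filt_append G l₁ l₂) _
    (ObjectProperty.extensionProduct_retractClosure_retractClosure_le _ _ _
      ⟨_, _, _, _, _, H, hX, hZ⟩)

/-- The list of all sums `a + k` with `a ∈ l` and `k ∈ l'`. -/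
def sums (l l' : List ℤ) : List ℤ := l'.flatMap fun k => l.map (· + k)

/-- Each layer `E⟦k⟧` of a filtration is replaced by a construction of `E` from `G`, shifted by `k`.
-/
lemma built_trans {G E X : T} {l l' : List ℤ} (hE : built G l E) (hX : built E l' X) :
    built G (sums l l') X := by
  obtain ⟨Y, hY, ⟨r⟩⟩ := hX
  refine built_of_retract r ?_
  clear r
  induction l' generalizing Y with
  | nil => exact built_of_isZero hY
  | cons k l' ih =>
    obtain ⟨A, B, f, g, δ, H, hA, ⟨e⟩⟩ := hY
    exact built_append H (ih _ hA) (built_of_iso e.symm (built_shift hE k))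

end Octahedral

end Filtrations

/-! ### Complexity as an infimum of weights of lists; Fekete's lemma. -/

section Complexity

variable {T : Type u} [Category.{v} T] [HasZeroObject T] [HasShift T ℤ] [Preadditive T]
  [∀ n : ℤ, (shiftFunctor T n).Additive] [Pretriangulated T]

/-- The weight `∑ exp (k t)` of a list of shifts. -/
noncomputable def weight (t : ℝ) (l : List ℤ) : ℝ≥0∞ :=
  (l.map fun k : ℤ => ENNReal.ofReal (Real.exp ((k : ℝ) * t))).sum

lemma filt_of_hasTower (G : T) {p : ℕ} {n : Fin p → ℤ} {E : T}
    (h : HasTower (fun i => G⟦n i⟧) E) :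
    ∃ l, filt G l E ∧
      ∀ t, weight t l = ∑ i, ENNReal.ofReal (Real.exp ((n i : ℝ) * t)) := by
  induction p generalizing E with
  | zero =>
    obtain ⟨M, h0, ⟨e⟩, -⟩ := h
    exact ⟨[], IsZero.of_iso h0 e.symm, fun t => by simp [weight]⟩
  | succ p ih =>
    obtain ⟨M, h0, ⟨e⟩, hM⟩ := h
    obtain ⟨l, hl, hw⟩ := ih (n := fun i => n i.castSucc) (E := M (Fin.last p).castSucc)
      ⟨fun i => M i.castSucc, h0, ⟨Iso.refl _⟩, fun i => hM i.castSucc⟩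
    obtain ⟨f, g, δ, H⟩ := hM (Fin.last p)
    refine ⟨n (Fin.last p) :: l, filt_of_iso e ⟨_, _, f, g, δ, H, hl, ⟨Iso.refl _⟩⟩, fun t => ?_⟩
    rw [Fin.sum_univ_castSucc, ← hw t, add_comm]
    simp [weight]

lemma HasTower.of_iso {p : ℕ} {A : Fin p → T} {E F : T} (h : HasTower A E) (e : E ≅ F) :
    HasTower A F := by
  obtain ⟨M, h0, ⟨e'⟩, hM⟩ := h
  exact ⟨M, h0, ⟨e' ≪≫ e⟩, hM⟩

lemma exists_distTriang_of_iso {X X' Y Y' Z Z' : T} (eX : X ≅ X') (eY : Y ≅ Y') (eZ : Z ≅ Z')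
    {f : X ⟶ Y} {g : Y ⟶ Z} {δ : Z ⟶ X⟦(1 : ℤ)⟧} (H : Triangle.mk f g δ ∈ distTriang T) :
    ∃ (f' : X' ⟶ Y') (g' : Y' ⟶ Z') (δ' : Z' ⟶ X'⟦(1 : ℤ)⟧),
      Triangle.mk f' g' δ' ∈ distTriang T :=
by
  have h₁ : (eX.inv ≫ f ≫ eY.hom) ≫ eY.inv = eX.inv ≫ f := by simp
  have h₂ : (eY.inv ≫ g ≫ eZ.hom) ≫ eZ.inv = eY.inv ≫ g := by simp
  have h₃ : (eZ.inv ≫ δ ≫ eX.hom⟦(1 : ℤ)⟧') ≫ eX.inv⟦(1 : ℤ)⟧' = eZ.inv ≫ δ := by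
    simp [← Functor.map_comp]
  exact ⟨eX.inv ≫ f ≫ eY.hom, eY.inv ≫ g ≫ eZ.hom, eZ.inv ≫ δ ≫ eX.hom⟦1⟧',
    isomorphic_distinguished _ H _ (Triangle.isoMk _ _ eX.symm eY.symm eZ.symm h₁ h₂ h₃)⟩

lemma HasTower.snoc {p : ℕ} {A : Fin p → T} {X Y Z : T} (h : HasTower A X)
    {f : X ⟶ Y} {g : Y ⟶ Z} {δ : Z ⟶ X⟦(1 : ℤ)⟧} (H : Triangle.mk f g δ ∈ distTriang T) :
    HasTower (Fin.snoc (α := fun _ => T) A Z) Y := by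
  obtain ⟨M, h0, ⟨e⟩, hM⟩ := h
  refine ⟨Fin.snoc (α := fun _ => T) M Y, ?_, ⟨eqToIso (Fin.snoc_last (α := fun _ => T) _ _)⟩,
    fun i => ?_⟩
  · rw [← Fin.castSucc_zero, Fin.snoc_castSucc]
    exact h0
  · induction i using Fin.lastCases with
    | last =>
      rw [Fin.succ_last, Fin.snoc_last, Fin.snoc_last, Fin.snoc_castSucc]
      exact exists_distTriang_of_iso e.symm (Iso.refl _) (Iso.refl _) H
    | cast i =>
      rw [Fin.succ_castSucc, Fin.snoc_castSucc, Fin.snoc_castSucc, Fin.snoc_castSucc]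
      exact hM i

lemma hasTower_of_filt (G : T) {l : List ℤ} {E : T} (h : filt G l E) :
    ∃ (p : ℕ) (n : Fin p → ℤ), HasTower (fun i => G⟦n i⟧) E ∧
      ∀ t, weight t l = ∑ i, ENNReal.ofReal (Real.exp ((n i : ℝ) * t)) := by
  induction l generalizing E with
  | nil => exact ⟨0, Fin.elim0, ⟨fun _ => E, h, ⟨Iso.refl _⟩, fun i => i.elim0⟩,
      fun t => by simp [weight]⟩
  | cons k l ih =>
    obtain ⟨X, Z, f, g, δ, H, hX, ⟨e⟩⟩ := h
    obtain ⟨p, n, hn, hw⟩ := ih hX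
    obtain ⟨f', g', δ', H'⟩ := exists_distTriang_of_iso (Iso.refl _) (Iso.refl _) e H
    refine ⟨p + 1, Fin.snoc (α := fun _ => ℤ) n k, ?_, fun t => ?_⟩
    · convert hn.snoc H' using 1
      funext i
      induction i using Fin.lastCases with
      | last => simp
      | cast i => simp
    · rw [Fin.sum_univ_castSucc]
      simp only [Fin.snoc_castSucc, Fin.snoc_last, ← hw t]
      simp [weight, add_comm]

/-- Retracts split in a triangulated category, so being a retract of a filtered object is the same
as having a complement `M` with `E ⊞ M` filtered. -/
lemma complexity_eq_iInf (t : ℝ) (G E : T) :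
    complexity t G E = ⨅ (l : List ℤ) (_ : built G l E), weight t l := by
  apply le_antisymm
  · refine le_iInf₂ fun l hl => ?_
    obtain ⟨Y, hY, ⟨r⟩⟩ := hl
    obtain ⟨M, ⟨e⟩⟩ := exists_iso_biprod_of_retract r
    obtain ⟨p, n, hn, hw⟩ := hasTower_of_filt G (filt_of_iso e hY)
    exact sInf_le ⟨p, n, M, hn, hw t⟩
  · refine le_sInf ?_
    rintro _ ⟨p, n, M, hn, rfl⟩
    obtain ⟨l, hl, hw⟩ := filt_of_hasTower G hn
    rw [← hw t]
    exact iInf₂_le l ⟨_, hl, ⟨⟨biprod.inl, biprod.fst, by simp⟩⟩⟩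

end Complexity

/-- Fekete's lemma for sequences with values in `[-∞, ∞)`. -/
lemma tendsto_div_of_subadditive {u : ℕ → EReal} (hu : ∀ m n, u (m + n) ≤ u m + u n)
    (htop : ∀ n, u n ≠ ⊤) :
    Tendsto (fun n : ℕ => u n / ((n : ℝ) : EReal)) atTop
      (𝓝 (⨅ (n : ℕ) (_ : n ≠ 0), u n / ((n : ℝ) : EReal))) := by
  refine tendsto_order.2 ⟨fun a ha => ?_, fun a ha => ?_⟩
  · filter_upwards [eventually_ne_atTop 0] with n hn
    exact ha.trans_le (iInf₂_le n hn)
  · simp only [iInf_lt_iff] at ha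
    obtain ⟨m, hm, hma⟩ := ha
    -- A single value `⊥` propagates to all later indices; otherwise the sequence is real and the
    -- classical lemma applies.
    by_cases hbot : ∃ k, u k = ⊥
    · obtain ⟨k, hk⟩ := hbot
      filter_upwards [eventually_ge_atTop k, eventually_ne_atTop 0] with n hn hn0
      obtain ⟨j, rfl⟩ := Nat.exists_eq_add_of_le hn
      have : u (k + j) = ⊥ := by
        have := hu k j
        rw [hk, EReal.bot_add] at this
        exact le_bot_iff.1 this
      rw [this, EReal.bot_div_of_pos_ne_top (by exact_mod_cast Nat.pos_of_ne_zero hn0)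
        (EReal.coe_ne_top _)]
      exact bot_le.trans_lt hma
    · push Not at hbot
      have hcoe : ∀ n, (((u n).toReal : ℝ) : EReal) = u n := fun n =>
        EReal.coe_toReal (htop n) (hbot n)
      have hsub : Subadditive fun n => (u n).toReal := fun i j => by
        have := hu i j
        rw [← hcoe i, ← hcoe j, ← hcoe (i + j)] at this
        exact_mod_cast this
      rw [← hcoe m, ← EReal.coe_div] at hma
      obtain ⟨b, hmb, hba⟩ := EReal.lt_iff_exists_real_btwn.1 hma
      filter_upwards [hsub.eventually_div_lt_of_div_lt hm (EReal.coe_lt_coe_iff.1 hmb)] with n hn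
      rw [← hcoe n, ← EReal.coe_div]
      exact (EReal.coe_lt_coe_iff.2 hn).trans hba

section Weight

lemma weight_sums (t : ℝ) (l l' : List ℤ) : weight t (sums l l') = weight t l * weight t l' := by
  induction l' with
  | nil => simp [weight, sums]
  | cons k l' ih =>
    have h : weight t (sums l (k :: l')) = weight t (l.map (· + k)) + weight t (sums l l') := by
      simp [weight, sums]
    have h' : weight t (l.map (· + k)) =
        weight t l * ENNReal.ofReal (Real.exp ((k : ℝ) * t)) := by
      simp only [weight, List.map_map, ← List.sum_map_mul_right]
      congr 2
      funext a
      simp only [Function.comp, Int.cast_add, add_mul, Real.exp_add]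
      rw [ENNReal.ofReal_mul (Real.exp_nonneg _)]
    rw [h, h', ih, ← mul_add]
    simp [weight]

lemma weight_ne_top (t : ℝ) (l : List ℤ) : weight t l ≠ ⊤ := by
  induction l with
  | nil => simp [weight]
  | cons k l ih => simpa [weight] using ih

lemma ofReal_exp_le_weight (t : ℝ) {l : List ℤ} {k : ℤ} (hk : k ∈ l) :
    ENNReal.ofReal (Real.exp ((k : ℝ) * t)) ≤ weight t l :=
  List.single_le_sum (fun _ _ => zero_le) _ (List.mem_map_of_mem hk)

/-- The `+ 1` keeps the logarithm's argument positive when the list is empty. -/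
lemma log_weight_le {t : ℝ} (ht : 0 ≤ t) {l : List ℤ} {k : ℤ} (hk : ∀ a ∈ l, a ≤ k) :
    ENNReal.log (weight t l) ≤ ((Real.log (l.length + 1) + k * t : ℝ) : EReal) := by
  have h : weight t l ≤ ENNReal.ofReal ((l.length + 1) * Real.exp (k * t)) := by
    calc weight t l ≤ l.length • ENNReal.ofReal (Real.exp (k * t)) := by
          have := List.sum_le_card_nsmul
            (l.map fun k : ℤ => ENNReal.ofReal (Real.exp ((k : ℝ) * t)))
            (ENNReal.ofReal (Real.exp (k * t))) (by
              simp only [List.mem_map]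
              rintro _ ⟨a, ha, rfl⟩
              have : (a : ℝ) ≤ k := by exact_mod_cast hk a ha
              gcongr)
          simpa [weight] using this
      _ = ENNReal.ofReal (l.length * Real.exp (k * t)) := by
          rw [ENNReal.ofReal_mul (by positivity), ENNReal.ofReal_natCast, nsmul_eq_mul]
      _ ≤ _ := by gcongr; linarith
  refine (ENNReal.log_le_log h).trans ?_
  rw [ENNReal.log_ofReal_of_pos (by positivity), Real.log_mul (by positivity) (by positivity),
    Real.log_exp]

end Weight

/-! ### Entropy, and its slope at infinity as the growth rate of shifts. -/

section Entropy

variable {T : Type u} [Category.{v} T] [HasZeroObject T] [HasShift T ℤ] [Preadditive T]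
  [∀ n : ℤ, (shiftFunctor T n).Additive] [Pretriangulated T]

/-- The entropy of `F` at `t`, as an infimum. -/
noncomputable def entropy (F : T ⥤ T) (G : T) (t : ℝ) : EReal :=
  ⨅ (n : ℕ) (_ : n ≠ 0), ENNReal.log (complexity t G (F.obj^[n] G)) / ((n : ℝ) : EReal)

/-- The growth rate of the largest shift needed to build `Fⁿ G` from `G`. -/
noncomputable def shiftGrowth (F : T ⥤ T) (G : T) : EReal :=
  ⨅ (n : ℕ) (_ : n ≠ 0) (k : ℤ) (_ : ∃ l, built G l (F.obj^[n] G) ∧ ∀ a ∈ l, a ≤ k),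
    ((k / n : ℝ) : EReal)

lemma built_iterate (F : T ⥤ T) [F.CommShift ℤ] [F.IsTriangulated] {G X : T} {l : List ℤ}
    (h : built G l X) (n : ℕ) : built (F.obj^[n] G) l (F.obj^[n] X) := by
  induction n with
  | zero => exact h
  | succ n ih =>
    rw [Function.iterate_succ_apply', Function.iterate_succ_apply']
    exact built_map F ih

/-- Applying `F` `m` times to a construction of `Fⁿ G` and substituting one of `Fᵐ G` multiplies the
weights. -/
lemma complexity_iterate_add_le [IsTriangulated T] (F : T ⥤ T) [F.CommShift ℤ] [F.IsTriangulated]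
    {G : T} (hG : ∀ E, ∃ l, built G l E) (t : ℝ) (m n : ℕ) :
    complexity t G (F.obj^[m + n] G) ≤
      complexity t G (F.obj^[m] G) * complexity t G (F.obj^[n] G) := by
  have hne : ∀ E, ∃ l : {l // built G l E}, weight t l ≠ ⊤ := fun E => by
    obtain ⟨l, hl⟩ := hG E
    exact ⟨⟨l, hl⟩, weight_ne_top t l⟩
  simp only [complexity_eq_iInf, iInf_subtype']
  refine ENNReal.le_iInf_mul_iInf (hne _) (hne _) fun i j => ?_
  rw [← weight_sums]
  refine iInf_le (fun l : {l // built G l (F.obj^[m + n] G)} => weight t l) ⟨_, ?_⟩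
  rw [Function.iterate_add_apply]
  exact built_trans i.2 (built_iterate F j.2 m)

lemma complexity_ne_top {G E : T} (hG : ∃ l, built G l E) (t : ℝ) : complexity t G E ≠ ⊤ := by
  obtain ⟨l, hl⟩ := hG
  rw [complexity_eq_iInf]
  exact ((iInf₂_le l hl).trans_lt (weight_ne_top t l).lt_top).ne

lemma isEntropyAt_entropy [IsTriangulated T] (F : T ⥤ T) [F.CommShift ℤ] [F.IsTriangulated]
    {G : T} (hG : ∀ E, ∃ l, built G l E) (t : ℝ) : IsEntropyAt F G t (entropy F G t) := by
  refine tendsto_div_of_subadditive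
    (u := fun n => ENNReal.log (complexity t G (F.obj^[n] G))) (fun m n => ?_) fun n => ?_
  · rw [← ENNReal.log_mul_add]
    exact ENNReal.log_le_log (complexity_iterate_add_le F hG t m n)
  · simpa using complexity_ne_top (hG _) t

lemma shiftGrowth_mul_le_log_weight (F : T ⥤ T) (G : T) {t : ℝ} (ht : 0 < t) {n : ℕ} (hn : n ≠ 0)
    {l : List ℤ} (hl : built G l (F.obj^[n] G)) :
    shiftGrowth F G * t * ((n : ℝ) : EReal) ≤ ENNReal.log (weight t l) := by
  have hn' : (0 : ℝ) < n := by exact_mod_cast Nat.pos_of_ne_zero hn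
  have key : ∀ k : ℤ, (∀ a ∈ l, a ≤ k) → shiftGrowth F G ≤ ((k / n : ℝ) : EReal) := fun k hk =>
    (iInf₂_le n hn).trans (iInf₂_le k ⟨l, hl, hk⟩)
  -- An empty list is bounded by every integer, which forces the growth rate to be `⊥`.
  rcases eq_or_ne l [] with rfl | hne
  · have : shiftGrowth F G = ⊥ := by
      refine EReal.eq_bot_iff_forall_lt _ |>.2 fun y => ?_
      obtain ⟨k, hk⟩ := exists_int_lt (y * n)
      refine (key k (by simp)).trans_lt (EReal.coe_lt_coe_iff.2 ?_)
      rwa [div_lt_iff₀ hn']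
    rw [this, EReal.bot_mul_coe_of_pos ht, EReal.bot_mul_coe_of_pos hn']
    exact bot_le
  · obtain ⟨k, hkl, hk⟩ : ∃ k ∈ l, ∀ a ∈ l, a ≤ k := by
      obtain ⟨k, hk, h⟩ := l.toFinset.exists_max_image id
        (by simpa [List.toFinset_nonempty_iff] using hne)
      exact ⟨k, by simpa using hk, fun a ha => h a (by simpa using ha)⟩
    calc shiftGrowth F G * t * ((n : ℝ) : EReal)
        ≤ ((k / n : ℝ) : EReal) * t * ((n : ℝ) : EReal) := by
          have h1 : (0 : EReal) ≤ (t : EReal) := by exact_mod_cast ht.le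
          have h2 : (0 : EReal) ≤ ((n : ℝ) : EReal) := by exact_mod_cast hn'.le
          exact mul_le_mul_of_nonneg_right (mul_le_mul_of_nonneg_right (key k hk) h1) h2
      _ = ((k * t : ℝ) : EReal) := by
          rw [← EReal.coe_mul, ← EReal.coe_mul]
          congr 1
          field_simp
      _ = ENNReal.log (ENNReal.ofReal (Real.exp (k * t))) := by
          rw [ENNReal.log_ofReal_of_pos (Real.exp_pos _), Real.log_exp]
      _ ≤ _ := ENNReal.log_le_log (ofReal_exp_le_weight t hkl)

lemma shiftGrowth_le_entropy_div (F : T ⥤ T) (G : T) {t : ℝ} (ht : 0 < t) :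
    shiftGrowth F G ≤ entropy F G t / t := by
  rw [EReal.le_div_iff_mul_le (by exact_mod_cast ht) (EReal.coe_ne_top _)]
  refine le_iInf₂ fun n hn => ?_
  rw [EReal.le_div_iff_mul_le (by exact_mod_cast Nat.pos_of_ne_zero hn) (EReal.coe_ne_top _),
    ← EReal.log_exp (shiftGrowth F G * t * ((n : ℝ) : EReal)), complexity_eq_iInf]
  refine ENNReal.log_le_log (le_iInf₂ fun l hl => ?_)
  rw [← ENNReal.log_le_log_iff, EReal.log_exp]
  exact shiftGrowth_mul_le_log_weight F G ht hn hl

/-- From below, one summand bounds the weight. From above, for a fixed construction, the number of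
summands only contributes a constant over `t`. -/
lemma tendsto_entropy_div (F : T ⥤ T) (G : T) :
    Tendsto (fun t : ℝ => entropy F G t / (t : EReal)) atTop (𝓝 (shiftGrowth F G)) := by
  refine tendsto_order.2 ⟨fun a ha => ?_, fun a ha => ?_⟩
  · filter_upwards [eventually_gt_atTop 0] with t ht
    exact ha.trans_le (shiftGrowth_le_entropy_div F G ht)
  · simp only [shiftGrowth, iInf_lt_iff] at ha
    obtain ⟨n, hn, k, ⟨l, hl, hk⟩, hlt⟩ := ha
    obtain ⟨b, hb, hba⟩ := EReal.lt_iff_exists_real_btwn.1 hlt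
    have hn' : (0 : ℝ) < n := by exact_mod_cast Nat.pos_of_ne_zero hn
    have hlim : Tendsto (fun t : ℝ => Real.log (l.length + 1) / n / t + k / n) atTop
        (𝓝 (0 + k / n)) :=
      (tendsto_const_nhds.div_atTop tendsto_id).add tendsto_const_nhds
    rw [zero_add] at hlim
    filter_upwards [eventually_gt_atTop 0, hlim.eventually (gt_mem_nhds (EReal.coe_lt_coe_iff.1 hb))]
      with t ht htb
    refine lt_of_le_of_lt ?_ ((EReal.coe_lt_coe_iff.2 htb).trans hba)
    have h1 : entropy F G t ≤
        ((Real.log (l.length + 1) + k * t : ℝ) : EReal) / ((n : ℝ) : EReal) := by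
      refine (iInf₂_le n hn).trans (EReal.div_le_div_right_of_nonneg (by exact_mod_cast hn'.le) ?_)
      refine le_trans (ENNReal.log_le_log ?_) (log_weight_le ht.le hk)
      rw [complexity_eq_iInf]
      exact iInf₂_le l hl
    refine (EReal.div_le_div_right_of_nonneg (by exact_mod_cast ht.le) h1).trans (le_of_eq ?_)
    rw [← EReal.coe_div, ← EReal.coe_div]
    congr 1
    field_simp

/-- The upper Serre dimension computed with given choices is the growth rate of shifts. -/
lemma eq_shiftGrowth_of_tendsto [IsTriangulated T] (F : T ⥤ T) [F.CommShift ℤ] [F.IsTriangulated]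
    {G : T} (hG : ∀ E, ∃ l, built G l E) {h : ℝ → EReal} (hh : ∀ t, IsEntropyAt F G t (h t))
    {d : EReal} (hd : Tendsto (fun t : ℝ => h t / (t : EReal)) atTop (𝓝 d)) :
    d = shiftGrowth F G := by
  have : h = entropy F G := by
    funext t
    exact tendsto_nhds_unique (hh t) (isEntropyAt_entropy F hG t)
  subst this
  exact tendsto_nhds_unique hd (tendsto_entropy_div F G)

end Entropy

/-! ### Extension closures and rearranging extensions. -/

section Closure

variable {T : Type u} [Category.{v} T] [HasZeroObject T] [HasShift T ℤ] [Preadditive T]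
  [∀ n : ℤ, (shiftFunctor T n).Additive] [Pretriangulated T]

/-- The closure of `W` under extensions (and zero objects). -/
inductive ExtClosure (W : ObjectProperty T) : T → Prop
  | zero {X : T} (h : IsZero X) : ExtClosure W X
  | of {X : T} (h : W X) : ExtClosure W X
  | ext {X Y Z : T} {f : X ⟶ Y} {g : Y ⟶ Z} {δ : Z ⟶ X⟦(1 : ℤ)⟧}
      (H : Triangle.mk f g δ ∈ distTriang T) (hX : ExtClosure W X) (hZ : ExtClosure W Z) :
      ExtClosure W Y

/-- The objects `A⟦k⟧` with `A` in `W` and `k ∈ I`. -/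
def shiftedBy (W : ObjectProperty T) (I : Set ℤ) : ObjectProperty T :=
  fun X => ∃ (A : T) (k : ℤ), k ∈ I ∧ W A ∧ Nonempty (X ≅ A⟦k⟧)

lemma ExtClosure.of_iso {W : ObjectProperty T} {X Y : T} (e : X ≅ Y) (h : ExtClosure W X) :
    ExtClosure W Y := by
  obtain ⟨f, g, δ, H⟩ := exists_distTriang_iso_zero e (isZero_zero T)
  exact .ext H h (.zero (isZero_zero T))

lemma ExtClosure.mono {W W' : ObjectProperty T} (hW : W ≤ W') {X : T} (h : ExtClosure W X) :
    ExtClosure W' X := by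
  induction h with
  | zero h => exact .zero h
  | of h => exact .of (hW _ h)
  | ext H _ _ h₁ h₂ => exact .ext H h₁ h₂

lemma ExtClosure.shift {W : ObjectProperty T} {X : T}
    (h : ExtClosure (shiftedBy W Set.univ) X) (n : ℤ) :
    ExtClosure (shiftedBy W Set.univ) (X⟦n⟧) := by
  induction h with
  | zero h => exact .zero (Functor.map_isZero _ h)
  | of h =>
    obtain ⟨A, k, -, hA, ⟨e⟩⟩ := h
    exact .of ⟨A, k + n, trivial, hA,
      ⟨(shiftFunctor T n).mapIso e ≪≫ ((shiftFunctorAdd T k n).app A).symm⟩⟩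
  | ext H _ _ h₁ h₂ => exact .ext (Triangle.shift_distinguished _ H n) h₁ h₂

lemma ExtClosure.hom_eq_zero_left {W : ObjectProperty T} {X Y : T} (h : ExtClosure W X)
    (hW : ∀ A, W A → ∀ f : A ⟶ Y, f = 0) (f : X ⟶ Y) : f = 0 := by
  induction h with
  | zero h => exact h.eq_of_src _ _
  | of h => exact hW _ h f
  | ext H _ _ h₁ h₂ =>
    obtain ⟨a, ha⟩ := Triangle.yoneda_exact₂ _ H f (h₁ _)
    rw [ha, h₂ a]
    exact comp_zero

lemma ExtClosure.hom_eq_zero_right {W : ObjectProperty T} {X Y : T} (n : ℤ) (h : ExtClosure W Y)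
    (hW : ∀ B, W B → ∀ f : X ⟶ B⟦n⟧, f = 0) (f : X ⟶ Y⟦n⟧) : f = 0 := by
  induction h with
  | zero h => exact (Functor.map_isZero _ h).eq_of_tgt _ _
  | of h => exact hW _ h f
  | ext H _ _ h₁ h₂ =>
    obtain ⟨a, ha⟩ := Triangle.coyoneda_exact₂ _ (Triangle.shift_distinguished _ H n) f (h₂ _)
    rw [ha, h₁ a]
    exact zero_comp

-- This makes the closure comparable with the triangulated envelope of a split-generator.
open scoped ZeroObject in
instance (W : ObjectProperty T) :
    ObjectProperty.IsTriangulated (C := T)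
      (ObjectProperty.retractClosure (ExtClosure (shiftedBy W Set.univ))) where
  exists_zero := ⟨0, isZero_zero T, ObjectProperty.le_retractClosure _ _ (.zero (isZero_zero T))⟩
  isStableUnderShiftBy n := ⟨fun X ⟨Y, hY, ⟨r⟩⟩ =>
    ⟨Y⟦n⟧, hY.shift n, ⟨r.map (shiftFunctor T n)⟩⟩⟩
  toIsTriangulatedClosed₂ := .mk' fun t ht h₁ h₃ => by
    refine ObjectProperty.monotone_retractClosure ?_ _
      (ObjectProperty.extensionProduct_retractClosure_retractClosure_le _ _ _
        ⟨_, _, _, _, _, ht, h₁, h₃⟩)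
    rintro X ⟨_, _, _, _, _, H, hY, hZ⟩
    exact .ext H hY hZ

/-- If a split-generator is in the extension closure of all the shifts of objects in `W`, then
every object is a retract of an object in this closure. -/
lemma IsSplitGenerator.retractClosure_extClosure {G : T} (hG : IsSplitGenerator G)
    {W : ObjectProperty T} (hW : ExtClosure (shiftedBy W Set.univ) G) (E : T) :
    ObjectProperty.retractClosure (ExtClosure (shiftedBy W Set.univ)) E := by
  have h : (ObjectProperty.singleton G).triangEnvelope ≤
      ObjectProperty.retractClosure (ExtClosure (shiftedBy W Set.univ)) := by
    rw [ObjectProperty.triangEnvelope_le_iff, ObjectProperty.singleton_le_iff]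
    exact ObjectProperty.le_retractClosure _ _ hW
  exact h E (by rw [show ObjectProperty.triangEnvelope _ = ⊤ from hG]; trivial)

lemma IsSplitGenerator.exists_built [IsTriangulated T] {G : T} (hG : IsSplitGenerator G) (E : T) :
    ∃ l, built G l E := by
  have hW : ExtClosure (shiftedBy (ObjectProperty.singleton G) Set.univ) G :=
    .of ⟨G, 0, trivial, by simp, ⟨((shiftFunctorZero T ℤ).app G).symm⟩⟩
  obtain ⟨Y, hY, ⟨r⟩⟩ := hG.retractClosure_extClosure hW E
  suffices ∃ l, built G l Y from this.imp fun l hl => built_of_retract r hl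
  clear r
  induction hY with
  | zero h => exact ⟨[], built_of_isZero h⟩
  | of h =>
    obtain ⟨A, k, -, hA, ⟨e⟩⟩ := h
    obtain rfl : G = A := by simpa using hA
    exact ⟨[k], built_of_iso e.symm (built_singleton _ k)⟩
  | ext H _ _ h₁ h₂ =>
    obtain ⟨l₁, h₁⟩ := h₁
    obtain ⟨l₂, h₂⟩ := h₂
    exact ⟨_, built_append H h₁ h₂⟩

open scoped ZeroObject in
/-- If `Hom (A, B⟦1⟧) = 0` for all `A` in `P` and `B` in `Q`, then any iterated extension of objects
of `P` and `Q` is an extension of an iterated extension of objects of `Q` by one of objects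
of `P`. -/
lemma extensionProduct_extClosure [IsTriangulated T] {P Q R : ObjectProperty T} (hR : R ≤ P ⊔ Q)
    (hPQ : ∀ A B, P A → Q B → ∀ f : A ⟶ B⟦(1 : ℤ)⟧, f = 0) {E : T} (hE : ExtClosure R E) :
    (ObjectProperty.extensionProduct (ExtClosure P) (ExtClosure Q)) E := by
  set LE : ObjectProperty T := ExtClosure P
  set GE : ObjectProperty T := ExtClosure Q
  have hext : ∀ W : ObjectProperty T,
      ObjectProperty.extensionProduct (ExtClosure W) (ExtClosure W) ≤ ExtClosure W := by
    rintro W X ⟨_, _, _, _, _, H, hY, hZ⟩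
    exact .ext H hY hZ
  have hzero : ∀ (W : ObjectProperty T), ObjectProperty.ContainsZero (C := T) (ExtClosure W) :=
    fun W => ⟨⟨0, isZero_zero T, .zero (isZero_zero T)⟩⟩
  have := hzero P
  have := hzero Q
  -- A layer from `P` on top of one from `Q` is attached by a zero map, so the extension is a direct
  -- sum and the two layers can be exchanged.
  have hswap : GE.extensionProduct LE ≤ LE.extensionProduct GE := by
    rintro X ⟨Y, Z, f, g, δ, H, hY, hZ⟩
    have hδ : δ = 0 := hZ.hom_eq_zero_left
      (fun A hA => hY.hom_eq_zero_right 1 fun B hB => hPQ A B hA hB) δ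
    obtain ⟨e, -⟩ := exists_iso_binaryBiproduct_of_distTriang _ H hδ
    exact (LE.extensionProduct GE).prop_of_iso
      (e ≪≫ biprod.braiding _ _).symm
      ⟨_, _, _, _, _, binaryBiproductTriangle_distinguished Z Y, hZ, hY⟩
  induction hE with
  | zero h => exact ObjectProperty.le_extensionProduct_left (P := LE) GE _ (.zero h)
  | of h =>
    rcases hR _ h with h | h
    · exact ObjectProperty.le_extensionProduct_left (P := LE) GE _ (.of h)
    · exact ObjectProperty.le_extensionProduct_right (Q := GE) LE _ (.of h)
  | ext H _ _ h₁ h₂ =>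
    have hle : (LE.extensionProduct GE).extensionProduct (LE.extensionProduct GE) ≤
        LE.extensionProduct GE := by
      calc (LE.extensionProduct GE).extensionProduct (LE.extensionProduct GE)
          = LE.extensionProduct ((GE.extensionProduct LE).extensionProduct GE) := by
            simp only [ObjectProperty.extensionProduct_assoc]
        _ ≤ LE.extensionProduct ((LE.extensionProduct GE).extensionProduct GE) :=
            ObjectProperty.monotone_extensionProduct_right _
              (ObjectProperty.monotone_extensionProduct_left _ hswap)
        _ = (LE.extensionProduct LE).extensionProduct (GE.extensionProduct GE) := by
            simp only [ObjectProperty.extensionProduct_assoc]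
        _ ≤ LE.extensionProduct (GE.extensionProduct GE) :=
            ObjectProperty.monotone_extensionProduct_left _ (hext P)
        _ ≤ LE.extensionProduct GE := ObjectProperty.monotone_extensionProduct_right _ (hext Q)
    exact hle _ ⟨_, _, _, _, _, H, h₁, h₂⟩

end Closure

/-! ### Slicings with split filtrations bound the Serre dimension. -/

section SplitSlicing

variable {T : Type u} [Category.{v} T] [HasZeroObject T] [HasShift T ℤ] [Preadditive T]
  [∀ n : ℤ, (shiftFunctor T n).Additive] [Pretriangulated T]

/-- The finite direct sums of objects in `P φ`, `φ ∈ I`. -/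
inductive SumsOf (P : ℝ → ObjectProperty T) (I : Set ℝ) : T → Prop
  | zero {X : T} (h : IsZero X) : SumsOf P I X
  | add {X A Y : T} {φ : ℝ} (hX : SumsOf P I X) (hφ : φ ∈ I) (hA : P φ A) (e : Y ≅ X ⊞ A) :
      SumsOf P I Y

variable {P : ℝ → ObjectProperty T} {I J : Set ℝ} {X Y : T}

lemma SumsOf.of_iso (h : SumsOf P I X) (e : X ≅ Y) : SumsOf P I Y := by
  cases h with
  | zero h => exact .zero (h.of_iso e.symm)
  | add hX hφ hA e' => exact .add hX hφ hA (e.symm ≪≫ e')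

lemma SumsOf.mono (hIJ : I ⊆ J) (h : SumsOf P I X) : SumsOf P J X := by
  induction h with
  | zero h => exact .zero h
  | add _ hφ hA e ih => exact .add ih (hIJ hφ) hA e

lemma SumsOf.exists_Iic (h : SumsOf P I X) : ∃ r : ℝ, SumsOf P (Set.Iic r) X := by
  induction h with
  | zero h => exact ⟨0, .zero h⟩
  | @add _ _ _ φ _ hφ hA e ih =>
    obtain ⟨r, hr⟩ := ih
    exact ⟨max r φ, .add (hr.mono (Set.Iic_subset_Iic.2 (le_max_left _ _)))
      (Set.mem_Iic.2 (le_max_right _ _)) hA e⟩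

lemma hom_eq_zero_of_iso_biprod {X A Y Z : T} (e : Y ≅ X ⊞ A) (hX : ∀ f : X ⟶ Z, f = 0)
    (hA : ∀ f : A ⟶ Z, f = 0) (f : Y ⟶ Z) : f = 0 := by
  rw [← cancel_epi e.inv, comp_zero]
  apply biprod.hom_ext'
  · rw [hX (biprod.inl ≫ e.inv ≫ f), comp_zero]
  · rw [hA (biprod.inr ≫ e.inv ≫ f), comp_zero]

lemma SumsOf.hom_eq_zero (h : SumsOf P I X)
    (hP : ∀ φ A, φ ∈ I → P φ A → ∀ f : A ⟶ Y, f = 0) (f : X ⟶ Y) : f = 0 := by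
  induction h with
  | zero h => exact h.eq_of_src _ _
  | add _ hφ hA e ih => exact hom_eq_zero_of_iso_biprod e ih (hP _ _ hφ hA) f

/-- A summand of phase above `r` has zero inclusion, hence is zero and can be dropped. -/
lemma SumsOf.Iic_of_hom_eq_zero (h : SumsOf P Set.univ X) {r : ℝ}
    (hX : ∀ φ A, r < φ → P φ A → ∀ f : A ⟶ X, f = 0) : SumsOf P (Set.Iic r) X := by
  induction h with
  | zero h => exact .zero h
  | @add X A Y φ _ _ hA e ih =>
    have ih' := ih fun ψ B hψ hB f => by
      have := hX ψ B hψ hB (f ≫ biprod.inl ≫ e.inv)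
      rw [← Category.assoc, ← cancel_mono e.hom, Category.assoc, e.inv_hom_id, zero_comp,
        Category.comp_id] at this
      rw [← cancel_mono (biprod.inl : X ⟶ X ⊞ A), this, zero_comp]
    rcases le_or_gt φ r with hφ | hφ
    · exact .add ih' hφ hA e
    · have h0 : (biprod.inr : A ⟶ X ⊞ A) = 0 := by
        rw [← cancel_mono e.inv, hX φ A hφ hA (biprod.inr ≫ e.inv), zero_comp]
      have hz : IsZero A := by
        rw [IsZero.iff_id_eq_zero, ← biprod.inr_snd (X := X) (Y := A), h0, zero_comp]
      refine ih'.of_iso (?_ ≪≫ e.symm)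
      exact ⟨biprod.inl, biprod.fst, by simp, by
        apply biprod.hom_ext'
        · simp
        · exact hz.eq_of_src _ _⟩

variable (T) in
/-- A slicing for which every object is a direct sum of semistable objects, and such that the
phases of semistable objects with a nonzero morphism `A ⟶ B` satisfy `φ(B) ≤ φ(A) + g`. -/
structure SplitSlicing (g : ℝ) where
  /-- the semistable objects of a given phase -/
  P : ℝ → ObjectProperty T
  of_iso {φ : ℝ} {A B : T} (e : A ≅ B) (h : P φ A) : P φ B
  shift {φ : ℝ} {A : T} (n : ℤ) (h : P φ A) : P (φ + n) (A⟦n⟧)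
  hom_eq_zero {φ ψ : ℝ} {A B : T} (h : φ + g < ψ) (hA : P φ A) (hB : P ψ B) (f : A ⟶ B) : f = 0
  decomposition (E : T) : SumsOf P Set.univ E

namespace SplitSlicing

variable {g : ℝ} (σ : SplitSlicing T g)

lemma sumsOf_shift {r : ℝ} {E : T} (n : ℤ) (h : SumsOf σ.P (Set.Iic r) E) :
    SumsOf σ.P (Set.Iic (r + n)) (E⟦n⟧) := by
  have : PreservesBinaryBiproducts (shiftFunctor T n) :=
    preservesBinaryBiproducts_of_preservesBiproducts _
  induction h with
  | zero h => exact .zero (Functor.map_isZero _ h)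
  | add _ hφ hA e ih =>
    exact .add ih (Set.mem_Iic.2 (add_le_add_left (Set.mem_Iic.1 hφ) _)) (σ.shift n hA)
      ((shiftFunctor T n).mapIso e ≪≫ (shiftFunctor T n).mapBiprod _ _)

lemma _root_.List.exists_forall_le (l : List ℤ) : ∃ c : ℤ, ∀ a ∈ l, a ≤ c := by
  obtain ⟨c, hc⟩ := l.toFinset.bddAbove
  exact ⟨c, fun a ha => hc (by simpa using ha)⟩

/-- The semistable objects with phase in `(0, 1]` which are built from `G` with shifts at
most `c`. -/
def bounded (G : T) (c : ℤ) : ObjectProperty T :=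
  fun A => (∃ φ ∈ Set.Ioc (0 : ℝ) 1, σ.P φ A) ∧ ∃ l, built G l A ∧ ∀ a ∈ l, a ≤ c

lemma bounded_mono (G : T) {c c' : ℤ} (h : c ≤ c') : σ.bounded G c ≤ σ.bounded G c' :=
  fun _ ⟨hA, l, hl, hc⟩ => ⟨hA, l, hl, fun a ha => (hc a ha).trans h⟩

/-- Semistable summands of `E` are retracts of `E`, so they are built from `G` too. There are
finitely many, so after shifting their phases into `(0, 1]` one bound `c` serves all. -/
lemma exists_extClosure_bounded {G E : T} (hE : SumsOf σ.P Set.univ E) {l : List ℤ}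
    (hl : built G l E) : ∃ c, ExtClosure (shiftedBy (σ.bounded G c) Set.univ) E := by
  induction hE with
  | zero h => exact ⟨0, .zero h⟩
  | @add X A Y φ _ _ hA e ih =>
    obtain ⟨c, hc⟩ := ih (built_of_retract ⟨biprod.inl ≫ e.inv, e.hom ≫ biprod.fst, by simp⟩ hl)
    have hl' : built G l A :=
      built_of_retract ⟨biprod.inr ≫ e.inv, e.hom ≫ biprod.snd, by simp⟩ hl
    set k : ℤ := 1 - ⌈φ⌉ with hk
    obtain ⟨c', hc'⟩ := (l.map (· + k)).exists_forall_le
    have hmono : ∀ {a : ℤ}, a ≤ max c c' →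
        shiftedBy (σ.bounded G a) Set.univ ≤ shiftedBy (σ.bounded G (max c c')) Set.univ := by
      rintro a ha B ⟨C, n, hn, hC, e⟩
      exact ⟨C, n, hn, σ.bounded_mono G ha _ hC, e⟩
    have hA' : σ.bounded G c' (A⟦k⟧) := by
      refine ⟨⟨φ + k, ⟨?_, ?_⟩, σ.shift k hA⟩, _, built_shift hl' k, hc'⟩
      · have := Int.ceil_lt_add_one φ
        rw [hk]; push_cast; linarith
      · have := Int.le_ceil φ
        rw [hk]; push_cast; linarith
    refine ⟨max c c', ExtClosure.of_iso e.symm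
      (.ext (binaryBiproductTriangle_distinguished X A) (hc.mono (hmono (le_max_left _ _)))
        ((ExtClosure.of ?_).mono (hmono (le_max_right _ _))))⟩
    exact ⟨A⟦k⟧, -k, trivial, hA', ⟨((shiftEquiv T k).unitIso.app A)⟩⟩

/-- If `g ≤ 1`, the objects of bounded phases are built from a split-generator with shifts bounded
by the largest phase, up to a constant. -/
theorem exists_built_of_sumsOf [IsTriangulated T] (hg : g ≤ 1) {G : T} (hG : IsSplitGenerator G) :
    ∃ c : ℤ, ∀ (E : T) (r : ℝ), SumsOf σ.P (Set.Iic r) E →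
      ∃ l, built G l E ∧ ∀ a ∈ l, a ≤ c + ⌈r⌉ := by
  obtain ⟨c, hc⟩ := σ.exists_extClosure_bounded (σ.decomposition G) (built_self G)
  set W := σ.bounded G c
  -- The source has phase at most `1` and the target phase greater than `2`; this gap suffices
  -- because `g ≤ 1`.
  have hsplit : ∀ A B, shiftedBy W (Set.Iic 0) A → shiftedBy W (Set.Ici 1) B →
      ∀ f : A ⟶ B⟦(1 : ℤ)⟧, f = 0 := by
    rintro A B ⟨A, k, hk, ⟨⟨φ, hφ, hA⟩, -⟩, ⟨eA⟩⟩ ⟨B, m, hm, ⟨⟨ψ, hψ, hB⟩, -⟩, ⟨eB⟩⟩ f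
    refine σ.hom_eq_zero ?_ (σ.of_iso eA.symm (σ.shift k hA))
      (σ.shift 1 (σ.of_iso eB.symm (σ.shift m hB))) f
    have hk' : (k : ℝ) ≤ 0 := by exact_mod_cast hk
    have hm' : (1 : ℝ) ≤ m := by exact_mod_cast hm
    have := hφ.2
    have := hψ.1
    push_cast
    linarith
  have hcover : shiftedBy W Set.univ ≤ shiftedBy W (Set.Iic 0) ⊔ shiftedBy W (Set.Ici 1) := by
    rintro A ⟨B, k, -, hB, e⟩
    rcases le_or_gt k 0 with hk | hk
    · exact Or.inl ⟨B, k, hk, hB, e⟩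
    · exact Or.inr ⟨B, k, hk, hB, e⟩
  have hLE : ∀ X, ExtClosure (shiftedBy W (Set.Iic 0)) X → ∃ l, built G l X ∧ ∀ a ∈ l, a ≤ c := by
    intro X hX
    induction hX with
    | zero h => exact ⟨[], built_of_isZero h, by simp⟩
    | of h =>
      obtain ⟨A, k, hk, ⟨-, l, hl, hlc⟩, ⟨e⟩⟩ := h
      refine ⟨_, built_of_iso e.symm (built_shift hl k), fun a ha => ?_⟩
      obtain ⟨b, hb, rfl⟩ := List.mem_map.1 ha
      have := hlc b hb
      have : k ≤ 0 := hk
      lia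
    | ext H _ _ h₁ h₂ =>
      obtain ⟨l₁, h₁, h₁c⟩ := h₁
      obtain ⟨l₂, h₂, h₂c⟩ := h₂
      refine ⟨_, built_append H h₁ h₂, fun a ha => ?_⟩
      rcases List.mem_append.1 ha with ha | ha
      · exact h₂c a ha
      · exact h₁c a ha
  -- `E` is a retract of some `F`, an extension of a part `Y` with positive shifts by a part `X`
  -- with nonpositive shifts. The pieces of `Y` have phase above `1`, so `E ⟶ F ⟶ Y` vanishes and
  -- `E` is already a retract of `X`.
  have hzero : ∀ E, SumsOf σ.P (Set.Iic 0) E → ∃ l, built G l E ∧ ∀ a ∈ l, a ≤ c := by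
    intro E hE
    obtain ⟨F, hF, ⟨r⟩⟩ := hG.retractClosure_extClosure hc E
    obtain ⟨X, Y, f, p, δ, H, hX, hY⟩ := extensionProduct_extClosure hcover hsplit hF
    have hrp : r.i ≫ p = 0 := by
      rw [← cancel_mono ((shiftFunctorZero T ℤ).inv.app Y), zero_comp]
      refine hY.hom_eq_zero_right 0 ?_ _
      rintro B ⟨B', m, hm, ⟨⟨ψ, hψ, hB⟩, -⟩, ⟨e⟩⟩
      refine fun a => hE.hom_eq_zero (fun φ A hφ hA => σ.hom_eq_zero ?_ hA
        (σ.shift 0 (σ.of_iso e.symm (σ.shift m hB)))) a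
      have hm' : (1 : ℝ) ≤ m := by exact_mod_cast hm
      have hφ' : φ ≤ 0 := hφ
      have := hψ.1
      push_cast
      linarith
    obtain ⟨s, hs⟩ := Triangle.coyoneda_exact₂ _ H r.i hrp
    obtain ⟨l, hl, hlc⟩ := hLE X hX
    refine ⟨l, built_of_retract ⟨s, f ≫ r.r, ?_⟩ hl, hlc⟩
    have hs' : r.i = s ≫ f := hs
    have h : (s ≫ f) ≫ r.r = 𝟙 E := by rw [← hs', r.retract]
    exact (Category.assoc _ _ _).symm.trans h
  refine ⟨c, fun E r hE => ?_⟩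
  have h0 : SumsOf σ.P (Set.Iic 0) (E⟦-⌈r⌉⟧) := by
    refine (σ.sumsOf_shift (-⌈r⌉) hE).mono (Set.Iic_subset_Iic.2 ?_)
    have := Int.le_ceil r
    push_cast
    linarith
  obtain ⟨l, hl, hlc⟩ := hzero _ h0
  refine ⟨_, built_of_iso ((shiftEquiv T ⌈r⌉).symm.unitIso.app E).symm (built_shift hl ⌈r⌉),
    fun a ha => ?_⟩
  obtain ⟨b, hb, rfl⟩ := List.mem_map.1 ha
  have := hlc b hb
  lia

section Serre

variable [Linear ℂ T] (S : SerreFunctor T)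

/-- `Hom(A, S E)` is dual to `Hom(E, A)`, which vanishes for `A` semistable of phase above `r + g`.
-/
lemma sumsOf_serreFunctor_obj {r : ℝ} {E : T} (hE : SumsOf σ.P (Set.Iic r) E) :
    SumsOf σ.P (Set.Iic (r + g)) (S.functor.obj E) := by
  refine (σ.decomposition _).Iic_of_hom_eq_zero fun φ A hφ hA f => ?_
  rw [← Module.forall_dual_apply_eq_zero_iff ℂ]
  intro θ
  obtain ⟨a, rfl⟩ := (S.duality E A).surjective θ
  have ha : a = 0 := hE.hom_eq_zero (fun ψ B hψ hB => σ.hom_eq_zero (by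
    have : ψ ≤ r := hψ
    linarith) hB hA) a
  rw [ha, map_zero, LinearMap.zero_apply]

lemma sumsOf_serreFunctor_iterate {r : ℝ} {E : T} (hE : SumsOf σ.P (Set.Iic r) E) (n : ℕ) :
    SumsOf σ.P (Set.Iic (r + n * g)) (S.functor.obj^[n] E) := by
  induction n with
  | zero => simpa using hE
  | succ n ih =>
    rw [Function.iterate_succ_apply']
    convert σ.sumsOf_serreFunctor_obj S ih using 2
    push_cast
    ring

theorem shiftGrowth_le [IsTriangulated T] (σ : SplitSlicing T g) (hg : g ≤ 1) {G : T} (hG : IsSplitGenerator G) :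
    shiftGrowth S.functor G ≤ (g : EReal) := by
  obtain ⟨c, hc⟩ := σ.exists_built_of_sumsOf hg hG
  obtain ⟨r, hr⟩ := (σ.decomposition G).exists_Iic
  -- The largest shift for `Sⁿ G` is at most `c + ⌈r + n * g⌉`; the `+ 1` absorbs the ceiling.
  have hlim : Tendsto (fun n : ℕ => (((c + r + 1) / n + g : ℝ) : EReal)) atTop
      (𝓝 ((0 + g : ℝ) : EReal)) :=
    (continuous_coe_real_ereal.tendsto _).comp
      ((tendsto_const_div_atTop_nhds_zero_nat _).add tendsto_const_nhds)
  rw [zero_add] at hlim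
  refine ge_of_tendsto hlim ?_
  filter_upwards [eventually_ne_atTop 0] with n hn
  refine (iInf₂_le n hn).trans ((iInf₂_le (c + ⌈r + n * g⌉)
    (hc _ _ (σ.sumsOf_serreFunctor_iterate S hr n))).trans (EReal.coe_le_coe_iff.2 ?_))
  have hn' : (0 : ℝ) < n := by exact_mod_cast Nat.pos_of_ne_zero hn
  have := Int.ceil_lt_add_one (r + n * g)
  rw [div_le_iff₀ hn', add_mul, div_mul_cancel₀ _ hn'.ne']
  push_cast
  linarith

end Serre

end SplitSlicing

end SplitSlicing

/-! ### From stability conditions to split slicings, and restriction to subcategories. -/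

section

variable {T : Type u} [Category.{v} T] [HasZeroObject T] [HasShift T ℤ] [Preadditive T]
  [∀ n : ℤ, (shiftFunctor T n).Additive] [Pretriangulated T]

lemma SumsOf.extClosure {P : ℝ → ObjectProperty T} {I : Set ℝ} {X : T} (h : SumsOf P I X) :
    ExtClosure (fun A => ∃ φ ∈ I, P φ A) X := by
  induction h with
  | zero h => exact .zero h
  | @add _ _ _ φ _ hφ hA e ih =>
    exact .of_iso e.symm (.ext (binaryBiproductTriangle_distinguished _ _) ih (.of ⟨φ, hφ, hA⟩))

namespace StabilityCondition

variable {Λ : Type w} [AddCommGroup Λ] {v : K0 T →+ Λ} {N : Seminorm ℝ (ℝ ⊗[ℤ] Λ)}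
  (σ : StabilityCondition T v N)

lemma shift_int {φ : ℝ} {A : T} (n : ℤ) (h : σ.P φ A) : σ.P (φ + n) (A⟦n⟧) := by
  induction n using Int.induction_on with
  | zero =>
    rw [Int.cast_zero, add_zero]
    exact σ.closedUnderIso φ ((shiftFunctorZero T ℤ).app A).symm h
  | succ n ih =>
    have := (σ.shift _ _).2 ih
    rw [add_assoc, ← Int.cast_one, ← Int.cast_add] at this
    exact σ.closedUnderIso _ ((shiftFunctorAdd T (n : ℤ) 1).app A).symm this
  | pred n ih =>
    rw [← σ.shift]
    have e := (shiftFunctorAdd' T (-(n : ℤ) - 1) 1 (-n) (by ring)).app A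
    rw [show φ + ((-(n : ℤ) - 1 : ℤ) : ℝ) + 1 = φ + ((-(n : ℤ) : ℤ) : ℝ) by push_cast; ring]
    exact σ.closedUnderIso _ e ih

lemma hom_eq_zero_of_gldim_le {g : ℝ} (hg : σ.gldim ≤ g) {φ ψ : ℝ} {A B : T} (h : φ + g < ψ)
    (hA : σ.P φ A) (hB : σ.P ψ B) (f : A ⟶ B) : f = 0 := by
  by_contra hf
  have : ((ψ - φ : ℝ) : EReal) ≤ g := by
    refine le_trans (le_sSup ?_) hg
    exact ⟨φ, ψ, A, B, hA, hB, ⟨f, hf⟩, rfl⟩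
  have := EReal.coe_le_coe_iff.1 this
  linarith

/-- If the global dimension is at most `1`, Harder–Narasimhan filtrations split. -/
lemma sumsOf_of_hasTower {g : ℝ} (hg : σ.gldim ≤ g) (hg1 : g ≤ 1) {p : ℕ} {φ : Fin p → ℝ}
    {A : Fin p → T} {E : T} (hφ : StrictAnti φ) (hA : ∀ i, σ.P (φ i) (A i)) (h : HasTower A E) :
    SumsOf σ.P (Set.range φ) E := by
  induction p generalizing E with
  | zero =>
    obtain ⟨M, h0, ⟨e⟩, -⟩ := h
    exact .zero (IsZero.of_iso h0 e.symm)
  | succ p ih =>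
    obtain ⟨M, h0, ⟨e⟩, hM⟩ := h
    have hX := ih (φ := fun i => φ i.castSucc) (A := fun i => A i.castSucc)
      (E := M (Fin.last p).castSucc) (fun i j hij => hφ (Fin.castSucc_lt_castSucc_iff.2 hij))
      (fun i => hA _) ⟨fun i => M i.castSucc, h0, ⟨Iso.refl _⟩, fun i => hM i.castSucc⟩
    obtain ⟨f, q, δ, H⟩ := hM (Fin.last p)
    -- The last quotient has the smallest phase, so every earlier factor shifted by one lies more
    -- than `1 ≥ g` above it.
    have hδ : δ = 0 := by
      refine hX.extClosure.hom_eq_zero_right 1 ?_ δ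
      rintro B ⟨_, ⟨i, rfl⟩, hB⟩
      refine σ.hom_eq_zero_of_gldim_le hg ?_ (hA _) (σ.shift_int 1 hB)
      have : φ (Fin.last p) < φ i.castSucc := hφ (Fin.castSucc_lt_last i)
      push_cast
      linarith
    obtain ⟨e', -⟩ := exists_iso_binaryBiproduct_of_distTriang _ H hδ
    refine .add (hX.mono ?_) (Set.mem_range_self (Fin.last p)) (hA _) (e.symm ≪≫ e')
    rintro _ ⟨i, rfl⟩
    exact Set.mem_range_self _

/-- A stability condition of global dimension at most `g ≤ 1` is a split slicing. -/
def splitSlicing {g : ℝ} (hg : σ.gldim ≤ g) (hg1 : g ≤ 1) : SplitSlicing T g where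
  P := σ.P
  of_iso := σ.closedUnderIso _
  shift := σ.shift_int
  hom_eq_zero := σ.hom_eq_zero_of_gldim_le hg
  decomposition E := by
    by_cases hE : IsZero E
    · exact .zero hE
    · obtain ⟨p, φ, A, hφ, hA, h⟩ := σ.harderNarasimhan E hE
      exact (σ.sumsOf_of_hasTower hg hg1 hφ hA h).mono (Set.subset_univ _)

end StabilityCondition

section FullyFaithful

/-- The essential image of a fully faithful left adjoint is closed under retracts. -/
lemma essImage_of_retract {C D : Type*} [Category* C] [Category* D] (F : D ⥤ C) [F.Full]
    [F.Faithful] [F.IsLeftAdjoint] {X Y : C} (r : Retract X Y) (h : F.essImage Y) :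
    F.essImage X := by
  let adj := Adjunction.ofIsLeftAdjoint F
  rw [← adj.isIso_counit_app_iff_mem_essImage] at h ⊢
  -- By naturality the counit at `X` is a retract of the counit at `Y`, and a retract of an
  -- isomorphism is one.
  let r' : RetractArrow (adj.counit.app X) (adj.counit.app Y) :=
    { i := Arrow.homMk (F.map (F.rightAdjoint.map r.i)) r.i (by simp)
      r := Arrow.homMk (F.map (F.rightAdjoint.map r.r)) r.r (by simp)
      retract := by
        ext
        · simp [← Functor.map_comp]
        · simp }
  exact (MorphismProperty.isomorphisms C).of_retract r' h

variable {D : Type*} [Category* D] [HasZeroObject D] [HasShift D ℤ] [Preadditive D]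
  [∀ n : ℤ, (shiftFunctor D n).Additive] [Pretriangulated D]
  (F : D ⥤ T) [F.Full] [F.Faithful]

/-- Summands of an object in the essential image lie in it again, so the decomposition lifts through
`F`. -/
lemma SumsOf.of_map [F.Additive] [F.IsLeftAdjoint] {P : ℝ → ObjectProperty T}
    (hP : ∀ {φ : ℝ} {A B : T}, (A ≅ B) → P φ A → P φ B) {I : Set ℝ} {Y : T} (h : SumsOf P I Y)
    {X : D} (e : F.obj X ≅ Y) : SumsOf (fun φ => (P φ).inverseImage F) I X := by
  have : PreservesBinaryBiproducts F := preservesBinaryBiproducts_of_preservesBiproducts _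
  induction h generalizing X with
  | zero h =>
    refine .zero ?_
    rw [IsZero.iff_id_eq_zero]
    exact F.map_injective ((h.of_iso e).eq_of_src _ _)
  | @add Y₁ A Y φ _ hφ hA e' ih =>
    have hY : F.essImage Y := ⟨X, ⟨e⟩⟩
    obtain ⟨X₁, ⟨e₁⟩⟩ := essImage_of_retract F
      (⟨biprod.inl ≫ e'.inv, e'.hom ≫ biprod.fst, by simp⟩ : Retract Y₁ Y) hY
    obtain ⟨X₂, ⟨e₂⟩⟩ := essImage_of_retract F
      (⟨biprod.inr ≫ e'.inv, e'.hom ≫ biprod.snd, by simp⟩ : Retract A Y) hY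
    exact .add (ih e₁) hφ (show P φ (F.obj X₂) from hP e₂.symm hA)
      (F.preimageIso (e ≪≫ e' ≪≫ (biprod.mapIso e₁ e₂).symm ≪≫ (F.mapBiprod X₁ X₂).symm))

/-- A split slicing restricts along a fully faithful functor which has a right adjoint. -/
def SplitSlicing.comap [F.Additive] [F.CommShift ℤ] [F.IsLeftAdjoint] {g : ℝ} (σ : SplitSlicing T g) : SplitSlicing D g where
  P φ := (σ.P φ).inverseImage F
  of_iso e h := σ.of_iso (F.mapIso e) h
  shift n h := σ.of_iso ((F.commShiftIso n).app _).symm (σ.shift n h)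
  hom_eq_zero h hA hB f := F.map_injective (by
    rw [F.map_zero]
    exact σ.hom_eq_zero h hA hB _)
  decomposition E := SumsOf.of_map (P := σ.P) F σ.of_iso (σ.decomposition (F.obj E)) (Iso.refl _)

/-- A right adjoint of a fully faithful triangulated functor sends a split-generator to a
split-generator. -/
lemma isSplitGenerator_rightAdjoint [IsTriangulated D] {R : T ⥤ D} (adj : F ⊣ R)
    [R.CommShift ℤ] [R.IsTriangulated] {G : T} (hG : IsSplitGenerator G) :
    IsSplitGenerator (R.obj G) := by
  let Q : ObjectProperty D := (ObjectProperty.singleton (R.obj G)).triangEnvelope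
  have : (Q.inverseImage R).IsStableUnderRetracts := ⟨fun r h => Q.prop_of_retract (r.map R) h⟩
  have hle : (ObjectProperty.singleton G).triangEnvelope ≤ Q.inverseImage R := by
    rw [ObjectProperty.triangEnvelope_le_iff, ObjectProperty.singleton_le_iff]
    exact ObjectProperty.le_triangEnvelope _ _ (by simp)
  refine eq_top_iff.2 fun X _ => ?_
  -- The unit is invertible since `F` is fully faithful, so every `X` is `R (F X)`.
  refine Q.prop_of_iso (asIso (adj.unit.app X)).symm (hle (F.obj X) ?_)
  rw [show ObjectProperty.triangEnvelope _ = ⊤ from hG]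
  trivial

end FullyFaithful

end

/-! ### Serre duality and its restriction to an admissible subcategory. -/

section Duality

variable {D : Type*} [Category* D] [Preadditive D] [Linear ℂ D]

/-- Two objects which corepresent the dual of the same functor are isomorphic. -/
lemma nonempty_iso_of_duality [∀ X Y : D, Module.Finite ℂ (X ⟶ Y)] {X Y Y' : D}
    (Ψ : ∀ W, (X ⟶ W) ≃ₗ[ℂ] Module.Dual ℂ (W ⟶ Y))
    (Φ : ∀ W, (X ⟶ W) ≃ₗ[ℂ] Module.Dual ℂ (W ⟶ Y'))
    (hΨ : ∀ {W W' : D} (a : X ⟶ W) (w : W ⟶ W') (b : W' ⟶ Y),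
      Ψ W' (a ≫ w) b = Ψ W a (w ≫ b))
    (hΦ : ∀ {W W' : D} (a : X ⟶ W) (w : W ⟶ W') (b : W' ⟶ Y'),
      Φ W' (a ≫ w) b = Φ W a (w ≫ b)) : Nonempty (Y ≅ Y') := by
  -- Finite-dimensionality allows dualizing back from the bidual; Yoneda then yields the
  -- isomorphism.
  let p (W : D) : (W ⟶ Y) ≃ₗ[ℂ] (W ⟶ Y') :=
    (Module.evalEquiv ℂ (W ⟶ Y)) ≪≫ₗ ((Φ W).symm ≪≫ₗ Ψ W).dualMap ≪≫ₗ
      (Module.evalEquiv ℂ (W ⟶ Y')).symm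
  have hp : ∀ {W : D} (a : X ⟶ W) (b : W ⟶ Y), Φ W a (p W b) = Ψ W a b := fun a b => by
    simp [p]
  refine ⟨Yoneda.ext _ _ (fun {W} => p W) (fun {W} => (p W).symm) (fun f => by simp)
    (fun f => by simp) fun {W W'} w b => ?_⟩
  rw [← sub_eq_zero, ← Module.forall_dual_apply_eq_zero_iff ℂ]
  intro θ
  obtain ⟨a, rfl⟩ := (Φ W').surjective θ
  rw [map_sub, hp, ← hΦ, hp, hΨ, sub_self]

/-- A functor with a natural duality `Hom (X, Y) ≅ Hom (Y, S X)^*` is fully faithful. -/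
lemma full_and_faithful_of_duality (S : D ⥤ D)
    (duality : ∀ X Y : D, (X ⟶ Y) ≃ₗ[ℂ] Module.Dual ℂ (Y ⟶ S.obj X))
    (natural : ∀ {X X' Y Y' : D} (f : X' ⟶ X) (a : X ⟶ Y) (g : Y ⟶ Y')
      (b : Y' ⟶ S.obj X'), duality X' Y' (f ≫ a ≫ g) b = duality X Y a (g ≫ b ≫ S.map f)) :
    S.Full ∧ S.Faithful := by
  -- The duality is determined by the functionals `duality X X (𝟙 X)`, which play the role of
  -- traces.
  have hl : ∀ {X Y : D} (a : X ⟶ Y) (b : Y ⟶ S.obj X),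
      duality X Y a b = duality X X (𝟙 X) (a ≫ b) := fun a b => by
    simpa using natural (𝟙 _) (𝟙 _) a b
  have hr : ∀ {X Y : D} (a : X ⟶ Y) (b : Y ⟶ S.obj X),
      duality X Y a b = duality Y Y (𝟙 Y) (b ≫ S.map a) := fun a b => by
    simpa using natural a (𝟙 _) (𝟙 _) b
  constructor
  · refine ⟨fun {X Y} c => ?_⟩
    let θ : Module.Dual ℂ (Y ⟶ S.obj X) :=
      duality Y Y (𝟙 Y) ∘ₗ Linear.rightComp ℂ Y c
    obtain ⟨a, ha⟩ := (duality X Y).surjective θ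
    refine ⟨a, ?_⟩
    rw [← sub_eq_zero, ← Module.forall_dual_apply_eq_zero_iff ℂ]
    intro ξ
    obtain ⟨b, rfl⟩ := (duality Y (S.obj X)).surjective ξ
    have h := LinearMap.congr_fun ha b
    rw [hr] at h
    rw [hl, Preadditive.comp_sub, map_sub, h, sub_eq_zero]
    simp [θ]
  · refine ⟨fun {X Y} a b hab => (duality X Y).injective (LinearMap.ext fun c => ?_)⟩
    rw [hr a, hr b, hab]

end Duality

section LinearAdjunction

variable {C D : Type*} [Category* C] [Preadditive C] [Linear ℂ C] [Category* D] [Preadditive D]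
  [Linear ℂ D] (F : D ⥤ C) [F.Additive] [F.Linear ℂ]

/-- The action of a fully faithful linear functor on morphisms. -/
noncomputable def mapLinearEquiv [F.Full] [F.Faithful] (X Y : D) : (X ⟶ Y) ≃ₗ[ℂ] (F.obj X ⟶ F.obj Y) :=
  LinearEquiv.ofBijective (F.mapLinearMap ℂ) ⟨F.map_injective, F.map_surjective⟩

lemma mapLinearEquiv_apply [F.Full] [F.Faithful] {X Y : D} (f : X ⟶ Y) : mapLinearEquiv F X Y f = F.map f := rfl

variable {F}

/-- The bijection of an adjunction whose left adjoint is linear, as a linear equivalence. -/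
noncomputable def homLinearEquivLeft {R : C ⥤ D} (adj : F ⊣ R) (X : D) (Z : C) :
    (X ⟶ R.obj Z) ≃ₗ[ℂ] (F.obj X ⟶ Z) where
  __ := (adj.homEquiv X Z).symm
  map_add' f g := by simp [Adjunction.homEquiv_counit]
  map_smul' c f := by simp [Adjunction.homEquiv_counit, Functor.map_smul]

/-- The bijection of an adjunction whose right adjoint is linear, as a linear equivalence. -/
noncomputable def homLinearEquivRight {L : C ⥤ D} (adj : L ⊣ F) (Z : C) (X : D) :
    (L.obj Z ⟶ X) ≃ₗ[ℂ] (Z ⟶ F.obj X) where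
  __ := adj.homEquiv Z X
  map_add' f g := by simp [Adjunction.homEquiv_unit]
  map_smul' c f := by simp [Adjunction.homEquiv_unit, Functor.map_smul]

lemma homLinearEquivRight_apply {L : C ⥤ D} (adj : L ⊣ F) {Z : C} {X : D} (f : L.obj Z ⟶ X) :
    homLinearEquivRight adj Z X f = adj.homEquiv Z X f := rfl

end LinearAdjunction

section Restriction

variable {T : Type u} [Category.{v} T] [HasZeroObject T] [HasShift T ℤ] [Preadditive T]
  [∀ n : ℤ, (shiftFunctor T n).Additive] [Pretriangulated T] [Linear ℂ T]
  {D : Type*} [Category* D] [Preadditive D] [Linear ℂ D]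
  {F : D ⥤ T} [F.Additive] [F.Linear ℂ] [F.Full] [F.Faithful]

namespace SerreFunctor

variable (S : SerreFunctor T) {R : T ⥤ D} (adj : F ⊣ R)

/-- The duality on `D` induced by a Serre functor of `T`. -/
noncomputable def restrictDuality (X Y : D) :
    (X ⟶ Y) ≃ₗ[ℂ] Module.Dual ℂ (Y ⟶ (F ⋙ S.functor ⋙ R).obj X) :=
  mapLinearEquiv F X Y ≪≫ₗ S.duality (F.obj X) (F.obj Y) ≪≫ₗ
    (homLinearEquivLeft adj Y (S.functor.obj (F.obj X))).dualMap

lemma restrictDuality_apply {X Y : D} (a : X ⟶ Y) (b : Y ⟶ (F ⋙ S.functor ⋙ R).obj X) :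
    S.restrictDuality adj X Y a b =
      S.duality (F.obj X) (F.obj Y) (F.map a) ((adj.homEquiv _ _).symm b) := rfl

lemma restrictDuality_natural {X X' Y Y' : D} (f : X' ⟶ X) (a : X ⟶ Y) (g : Y ⟶ Y')
    (b : Y' ⟶ (F ⋙ S.functor ⋙ R).obj X') :
    S.restrictDuality adj X' Y' (f ≫ a ≫ g) b =
      S.restrictDuality adj X Y a (g ≫ b ≫ (F ⋙ S.functor ⋙ R).map f) := by
  rw [restrictDuality_apply, restrictDuality_apply, F.map_comp, F.map_comp, S.duality_natural]
  congr 1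
  rw [adj.homEquiv_naturality_left_symm]
  congr 1
  exact (adj.homEquiv_naturality_right_symm b (S.functor.map (F.map f))).symm

/-- Full faithfulness is formal. For essential surjectivity the left adjoint is needed: if `S Z ≅ F
Y`, then `Hom(L Z, W) ≅ Hom(Z, F W)` is dual to `Hom(F W, F Y) ≅ Hom(W, Y)`, so `Y` is the image of
`L Z`. -/
lemma isEquivalence_restrict (adj : F ⊣ R) [∀ X Y : D, Module.Finite ℂ (X ⟶ Y)] {L : T ⥤ D} (adj' : L ⊣ F) :
    (F ⋙ S.functor ⋙ R).IsEquivalence := by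
  obtain ⟨_, _⟩ := full_and_faithful_of_duality _ (S.restrictDuality adj)
    (S.restrictDuality_natural adj)
  have := S.isEquivalence
  refine { essSurj := ⟨fun Y => ?_⟩ }
  obtain ⟨Z, ⟨e⟩⟩ := Functor.EssSurj.mem_essImage (F := S.functor) (F.obj Y)
  let Ψ (W : D) : (L.obj Z ⟶ W) ≃ₗ[ℂ] Module.Dual ℂ (W ⟶ Y) :=
    homLinearEquivRight adj' Z W ≪≫ₗ S.duality Z (F.obj W) ≪≫ₗ
      (mapLinearEquiv F W Y ≪≫ₗ Linear.homCongr ℂ (Iso.refl _) e.symm).dualMap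
  have hΨ : ∀ {W : D} (a : L.obj Z ⟶ W) (b : W ⟶ Y),
      Ψ W a b = S.duality Z (F.obj W) (adj'.homEquiv Z W a) (F.map b ≫ e.inv) := fun a b => by
    simp [Ψ, homLinearEquivRight_apply, mapLinearEquiv_apply, Linear.homCongr_apply]
  obtain ⟨i⟩ := nonempty_iso_of_duality Ψ (S.restrictDuality adj (L.obj Z))
    (fun a w b => by
      have := S.duality_natural (𝟙 Z) (adj'.homEquiv Z _ a) (F.map w) (F.map b ≫ e.inv)
      rw [hΨ, hΨ, adj'.homEquiv_naturality_right, F.map_comp]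
      simpa using this)
    (fun a w b => by simpa using S.restrictDuality_natural adj (𝟙 _) a w b)
  exact ⟨L.obj Z, ⟨i.symm⟩⟩

/-- A Serre functor restricts to a fully faithful triangulated subcategory whose inclusion has a
left and a right adjoint. -/
noncomputable def restrict [HasZeroObject D] [HasShift D ℤ]
    [∀ n : ℤ, (shiftFunctor D n).Additive] [Pretriangulated D] [F.CommShift ℤ] [F.IsTriangulated]
    [∀ X Y : D, Module.Finite ℂ (X ⟶ Y)] {L : T ⥤ D} (adj' : L ⊣ F) :
    SerreFunctor D :=
  letI := S.commShift
  letI := adj.rightAdjointCommShift ℤ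
  haveI := adj.commShift_of_leftAdjoint ℤ
  haveI := S.isTriangulated
  haveI := adj.isTriangulated_rightAdjoint
  { functor := F ⋙ S.functor ⋙ R
    commShift := inferInstance
    isTriangulated := inferInstance
    isEquivalence := S.isEquivalence_restrict adj adj'
    duality := S.restrictDuality adj
    duality_natural := S.restrictDuality_natural adj }

end SerreFunctor

end Restriction

/-! ### Existence and bound of the upper Serre dimension; conclusion. -/

section

variable {T : Type u} [Category.{v} T] [HasZeroObject T] [HasShift T ℤ] [Preadditive T]
  [∀ n : ℤ, (shiftFunctor T n).Additive] [Pretriangulated T] [IsTriangulated T] [Linear ℂ T]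

/-- The upper Serre dimension is defined as soon as there are a Serre functor and a
split-generator. -/
lemma isUpperSerreDim_shiftGrowth (S : SerreFunctor T) {G : T} (hG : IsSplitGenerator G) :
    IsUpperSerreDim T (shiftGrowth S.functor G) :=
  letI := S.commShift
  haveI := S.isTriangulated
  ⟨S, G, entropy S.functor G, hG, isEntropyAt_entropy S.functor hG.exists_built,
    tendsto_entropy_div _ _⟩

lemma SplitSlicing.le_of_isUpperSerreDim {g : ℝ} (σ : SplitSlicing T g) (hg : g ≤ 1) {d : EReal}
    (hd : IsUpperSerreDim T d) : d ≤ g := by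
  obtain ⟨S, G, h, hG, hh, hlim⟩ := hd
  let _ := S.commShift
  have := S.isTriangulated
  rw [eq_shiftGrowth_of_tendsto S.functor hG.exists_built hh hlim]
  exact σ.shiftGrowth_le S hg hG

end

end SerreDim

theorem corollary5p3 {T : Type u} [Category.{v} T] [HasZeroObject T] [HasShift T ℤ]
    [Preadditive T] [∀ n : ℤ, (shiftFunctor T n).Additive] [Pretriangulated T] [IsTriangulated T]
    [Linear ℂ T] [∀ n : ℤ, (shiftFunctor T n).Linear ℂ]
    [∀ X Y : T, Module.Finite ℂ (X ⟶ Y)]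
    {Λ : Type w} [AddCommGroup Λ] [Module.Finite ℤ Λ] [Module.Free ℤ Λ]
    (v : SerreDim.K0 T →+ Λ) (hv : Function.Surjective v)
    (N : Seminorm ℝ (ℝ ⊗[ℤ] Λ)) (hN : ∀ x, N x = 0 → x = 0)
    (σ : SerreDim.StabilityCondition T v N)
    (d : EReal) (hd : SerreDim.IsUpperSerreDim T d) (hσ : d = σ.gldim) (h1 : d ≤ 1)
    (T' : ObjectProperty T) [T'.IsTriangulated] (hadm : SerreDim.IsAdmissible T')
    (hne : ∃ X : T, T' X ∧ ¬ IsZero X) :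
    (∃ d' : EReal, SerreDim.IsUpperSerreDim T'.FullSubcategory d') ∧
      ∀ d' : EReal, SerreDim.IsUpperSerreDim T'.FullSubcategory d' → d' ≤ d := by
  have hR : T'.ι.IsLeftAdjoint := hadm.1
  have hL : T'.ι.IsRightAdjoint := hadm.2
  have hfin : ∀ X Y : T'.FullSubcategory, Module.Finite ℂ (X ⟶ Y) := fun X Y =>
    Module.Finite.equiv (SerreDim.mapLinearEquiv T'.ι X Y).symm
  refine ⟨?_, fun d' hd' => ?_⟩
  · obtain ⟨S, G, -, hG, -⟩ := hd
    let adj := Adjunction.ofIsLeftAdjoint T'.ι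
    let _ := adj.rightAdjointCommShift ℤ
    have := adj.commShift_of_leftAdjoint ℤ
    have := adj.isTriangulated_rightAdjoint
    exact ⟨_, SerreDim.isUpperSerreDim_shiftGrowth
      (S.restrict adj (Adjunction.ofIsRightAdjoint T'.ι))
      (SerreDim.isSplitGenerator_rightAdjoint T'.ι adj hG)⟩
  -- Real numbers `g > d` are used since `d` is only an extended real; truncating at `1` keeps the
  -- slicing split.
  · refine EReal.le_of_forall_lt_iff_le.1 fun g hg => ?_
    have hg' : σ.gldim ≤ ((min g 1 : ℝ) : EReal) := by
      rw [← hσ]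
      rcases le_total g 1 with h | h
      · rw [min_eq_left h]
        exact hg.le
      · rwa [min_eq_right h]
    have := (((σ.splitSlicing hg' (min_le_right _ _)).comap T'.ι).le_of_isUpperSerreDim
      (min_le_right _ _) hd')
    exact this.trans (EReal.coe_le_coe_iff.2 (min_le_left _ _))
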